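/- All Banach spaces are real, and "subspace" means closed linear subspace. A Banach space $Y$ is *almost square* if for every $\varepsilon>0$ and every finite subset $\{y_1,\dots,y_N\}$ of the unit sphere $S_Y$ there is $y\in S_Y$ with $\|y_n-y\|\le 1+\varepsilon$ for all $n$ (the empty set is allowed, so $\{0\}$ is not almost square). A subspace $X$ of $Y$ is an *almost isometric ideal* (ai-ideal) in $Y$ if for every $\varepsilon>0$ and every finite-dimensional subspace $E$ of $Y$ there is a linear operator $T:E\to X$ such that $Te=e$ for all $e\in E\cap X$ and $(1-\varepsilon)\|e\|\le\|Te\|\le(1+\varepsilon)\|e\|$ for all $e\in E$. A Banach space *contains a copy of* $c_0$ if it has a subspace linearly homeomorphic to $c_0$, the space of real null sequences with the supremum norm. **Theorem.** Let $Y$ be a Banach space. The following statements are equivalent: (a) $Y$ is almost square. (b) Every separable ai-ideal in $Y$ is almost square. (c) Every subspace $X$ of $Y$ such that $Y/X$ does not contain a copy of $c_0$ is almost square. (d) Every subspace of finite codimension in $Y$ is almost square. -/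

import Mathlib

open scoped ZeroAtInfty

/-- A normed space `Y` is almost square if for every `ε > 0` and every finite subset `s` of its
unit sphere there is a unit vector `y` with `‖x - y‖ ≤ 1 + ε` for every `x ∈ s`. -/
def IsAlmostSquare (Y : Type*) [NormedAddCommGroup Y] [NormedSpace ℝ Y] : Prop :=
  ∀ ε : ℝ, 0 < ε → ∀ s : Finset Y, (∀ x ∈ s, ‖x‖ = 1) →
    ∃ y : Y, ‖y‖ = 1 ∧ ∀ x ∈ s, ‖x - y‖ ≤ 1 + ε

/-- `X` is an almost isometric ideal in `Y`: every finite-dimensional subspace `E` of `Y` can,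
for every `ε > 0`, be mapped into `X` by a linear `(1 ± ε)`-isometry fixing `E ∩ X` pointwise. -/
def IsAIIdeal {Y : Type*} [NormedAddCommGroup Y] [NormedSpace ℝ Y] (X : Submodule ℝ Y) : Prop :=
  ∀ ε : ℝ, 0 < ε → ∀ E : Submodule ℝ Y, FiniteDimensional ℝ E →
    ∃ T : E →ₗ[ℝ] X,
      (∀ e : E, (e : Y) ∈ X → ((T e : X) : Y) = e) ∧
      ∀ e : E, (1 - ε) * ‖e‖ ≤ ‖T e‖ ∧ ‖T e‖ ≤ (1 + ε) * ‖e‖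

/-- `Z` contains a copy of `c₀`: some linear subspace of `Z` is linearly homeomorphic to `c₀`, the
space `C₀(ℕ, ℝ)` of real null sequences with the supremum norm. -/
def ContainsCopyOfCZero (Z : Type*) [SeminormedAddCommGroup Z] [NormedSpace ℝ Z] : Prop :=
  ∃ W : Submodule ℝ Z, Nonempty (C₀(ℕ, ℝ) ≃L[ℝ] W)

/-! The implications (a) ⇔ (b) and (a) ⇒ (c) ⇒ (d) ⇒ (a) are proved. An ai-ideal inherits almost
squareness because the operator `T` carries a witness from `Y` into the ideal and fixes the given
vectors. Conversely, any finite set lies in a separable ai-ideal, built by a countable closing-off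
argument (`exists_separable_isAIIdeal`), and a witness there is a witness in `Y`.

For (a) ⇒ (c), repeated use of almost squareness gives a sequence of witnesses `y n` all of whose
signed sums have norm at most 2, so their series is weakly unconditionally Cauchy
(`IsAlmostSquare.exists_seq`). If the images in `Y ⧸ X` stayed away from 0, a subsequence would span
a copy of `c₀` by Rosenthal's lemma (`containsCopyOfCZero_of_dual`). Hence some `y n` is close to
`X`, and a nearby vector of `X` is an approximate witness. A finite-dimensional quotient contains no
`c₀`, and `X = ⊤` turns (d) into (a). -/

/-- It suffices to find the witnesses of almost squareness among almost normalised vectors. -/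
theorem IsAlmostSquare.of_approx {Y : Type*} [NormedAddCommGroup Y] [NormedSpace ℝ Y]
    (h : ∀ ε : ℝ, 0 < ε → ∀ s : Finset Y, (∀ x ∈ s, ‖x‖ = 1) →
      ∃ y : Y, |‖y‖ - 1| ≤ ε ∧ ∀ x ∈ s, ‖x - y‖ ≤ 1 + ε) : IsAlmostSquare Y := by
  intro ε hε s hs
  obtain ⟨y, hy, hys⟩ := h (min (ε / 2) (1 / 2)) (by positivity) s hs
  have h1 : |‖y‖ - 1| ≤ ε / 2 := hy.trans (min_le_left _ _)
  have h2 : |‖y‖ - 1| ≤ 1 / 2 := hy.trans (min_le_right _ _)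
  have hpos : 0 < ‖y‖ := by linarith [(abs_le.1 h2).1]
  have hdist : ‖y - ‖y‖⁻¹ • y‖ = |‖y‖ - 1| := by
    have : y - ‖y‖⁻¹ • y = (1 - ‖y‖⁻¹) • y := by module
    rw [this, norm_smul, Real.norm_eq_abs, ← abs_of_pos hpos, ← abs_mul, abs_of_pos hpos]
    congr 1
    field_simp
  refine ⟨‖y‖⁻¹ • y, by rw [norm_smul, norm_inv, norm_norm, inv_mul_cancel₀ hpos.ne'], fun x hx ↦ ?_⟩
  calc ‖x - ‖y‖⁻¹ • y‖ = ‖(x - y) + (y - ‖y‖⁻¹ • y)‖ := by congr 1; abel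
    _ ≤ ‖x - y‖ + ‖y - ‖y‖⁻¹ • y‖ := norm_add_le _ _
    _ ≤ (1 + ε / 2) + ε / 2 := by
        rw [hdist]
        gcongr
        exact (hys x hx).trans (by gcongr; exact min_le_left _ _)
    _ = 1 + ε := by ring

/-! ### Almost isometric ideals and separable determination. -/

section Ideals

variable {Y : Type*} [NormedAddCommGroup Y] [NormedSpace ℝ Y]

/-- Almost squareness passes to almost isometric ideals. -/
theorem IsAlmostSquare.of_isAIIdeal (hY : IsAlmostSquare Y) {X : Submodule ℝ Y}
    (hX : IsAIIdeal X) : IsAlmostSquare X := by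
  classical
  refine .of_approx fun ε hε s hs ↦ ?_
  -- For `η ≤ 1`, `(1 + η)² ≤ 1 + 3η ≤ 1 + ε`.
  set η := min (ε / 3) 1 with hη
  have hη0 : 0 < η := by positivity
  have hη1 : η ≤ 1 := min_le_right _ _
  have hη3 : η ≤ ε / 3 := min_le_left _ _
  obtain ⟨y, hy, hys⟩ := hY η hη0 (s.image X.subtype) (by simpa using hs)
  let E : Submodule ℝ Y := Submodule.span ℝ (insert y (s.image X.subtype) : Finset Y)
  have hyE : y ∈ E := Submodule.subset_span (by simp)
  have hsE : ∀ x ∈ s, (x : Y) ∈ E := fun x hx ↦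
    Submodule.subset_span (by simpa using Or.inr hx)
  obtain ⟨T, hT, hTn⟩ := hX η hη0 E inferInstance
  refine ⟨T ⟨y, hyE⟩, ?_, fun x hx ↦ ?_⟩
  · have := hTn ⟨y, hyE⟩
    simp only [Submodule.coe_norm, hy] at this ⊢
    rw [abs_le]
    constructor <;> linarith [this.1, this.2]
  · have hTx : T ⟨x, hsE x hx⟩ = x := Subtype.ext (hT ⟨x, hsE x hx⟩ x.2)
    have h1 := (hTn (⟨x, hsE x hx⟩ - ⟨y, hyE⟩)).2
    rw [map_sub, hTx] at h1
    have h2 : ‖(⟨x, hsE x hx⟩ - ⟨y, hyE⟩ : E)‖ ≤ 1 + η :=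
      hys x (Finset.mem_image_of_mem _ hx)
    refine h1.trans ?_
    nlinarith

/-- Every tuple of vectors of `Y` can be replaced by a tuple in `X` without changing much the
norms of linear combinations with any given tuple in `S`. -/
def Reflects (S X : Set Y) : Prop :=
  ∀ (m k : ℕ) (f : Fin m → Y), (∀ i, f i ∈ S) → ∀ (g : Fin k → Y) (δ : ℝ), 0 < δ →
    ∃ d : Fin k → Y, (∀ j, d j ∈ X) ∧ ∀ (b : Fin m → ℝ) (c : Fin k → ℝ),
      |‖∑ i, b i • f i + ∑ j, c j • g j‖ - ‖∑ i, b i • f i + ∑ j, c j • d j‖|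
        ≤ δ * (∑ i, |b i| + ∑ j, |c j|)

theorem Reflects.mono {S S' X X' : Set Y} (h : Reflects S X) (hS : S' ⊆ S) (hX : X ⊆ X') :
    Reflects S' X' := fun m k f hf g δ hδ ↦
  let ⟨d, hd, hd'⟩ := h m k f (fun i ↦ hS (hf i)) g δ hδ
  ⟨d, fun j ↦ hX (hd j), hd'⟩

/-- Moving each `f i` by less than `δ / 3` changes each of the two norms by at most `δ / 3 * ∑ |b
i|`; reflecting the moved tuple costs a third `δ / 3`. -/
theorem Reflects.closure {S X : Set Y} (h : Reflects S X) : Reflects (closure S) X := by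
  intro m k f hf g δ hδ
  choose f' hf' hff' using fun i ↦ Metric.mem_closure_iff.1 (hf i) (δ / 3) (by positivity)
  obtain ⟨d, hd, hd'⟩ := h m k f' hf' g (δ / 3) (by positivity)
  refine ⟨d, hd, fun b c ↦ ?_⟩
  have key (u : Y) : |‖∑ i, b i • f i + u‖ - ‖∑ i, b i • f' i + u‖| ≤ δ / 3 * ∑ i, |b i| := by
    refine (abs_norm_sub_norm_le _ _).trans ?_
    rw [add_sub_add_right_eq_sub, ← Finset.sum_sub_distrib, Finset.mul_sum]
    refine norm_sum_le_of_le _ fun i _ ↦ ?_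
    rw [← smul_sub, norm_smul, mul_comm, Real.norm_eq_abs]
    gcongr
    rw [← dist_eq_norm]
    exact (hff' i).le
  have h1 := key (∑ j, c j • g j)
  have h2 := key (∑ j, c j • d j)
  have h3 := hd' b c
  have h4 : 0 ≤ ∑ j, |c j| := Finset.sum_nonneg fun _ _ ↦ abs_nonneg _
  rw [abs_le] at *
  constructor <;> nlinarith

/-- A subspace that reflects all tuples of `Y` over itself is an almost isometric ideal. -/
theorem Reflects.isAIIdeal {X : Submodule ℝ Y} (h : Reflects (X : Set Y) X) : IsAIIdeal X := by
  intro ε hε E hE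
  let P : Submodule ℝ E := X.comap E.subtype
  obtain ⟨Q, hPQ⟩ := P.exists_isCompl
  let p := Module.finBasis ℝ P
  let q := Module.finBasis ℝ Q
  let πP := P.projectionOnto Q hPQ
  let πQ := Q.projectionOnto P hPQ.symm
  let L : E →L[ℝ] ((Fin (Module.finrank ℝ P) → ℝ) × (Fin (Module.finrank ℝ Q) → ℝ)) :=
    LinearMap.toContinuousLinearMap
      ((p.equivFun.toLinearMap ∘ₗ πP).prod (q.equivFun.toLinearMap ∘ₗ πQ))
  -- `C` bounds the ℓ¹-norm of the coordinates of `e` by `‖e‖`, so reflecting with error `ε / (C +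
  -- 1)` gives error at most `ε * ‖e‖`.
  set C : ℝ := Module.finrank ℝ P * ‖L‖ + Module.finrank ℝ Q * ‖L‖ with hC
  have hC0 : 0 ≤ C := by positivity
  have hL (e : E) : ∑ i, |p.equivFun (πP e) i| + ∑ j, |q.equivFun (πQ e) j| ≤ C * ‖e‖ := by
    have h1 (i) : |p.equivFun (πP e) i| ≤ ‖L‖ * ‖e‖ :=
      ((norm_le_pi_norm (L e).1 i).trans (norm_fst_le _)).trans (L.le_opNorm e)
    have h2 (j) : |q.equivFun (πQ e) j| ≤ ‖L‖ * ‖e‖ :=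
      ((norm_le_pi_norm (L e).2 j).trans (norm_snd_le _)).trans (L.le_opNorm e)
    have h3 := Finset.sum_le_sum fun i (_ : i ∈ Finset.univ) ↦ h1 i
    have h4 := Finset.sum_le_sum fun j (_ : j ∈ Finset.univ) ↦ h2 j
    simp only [Finset.sum_const, Finset.card_univ, Fintype.card_fin, nsmul_eq_mul] at h3 h4
    rw [hC]
    linarith
  obtain ⟨d, hd, hd'⟩ := h _ _ (fun i ↦ ((p i : E) : Y)) (fun i ↦ (p i).2)
    (fun j ↦ ((q j : E) : Y)) (ε / (C + 1)) (by positivity)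
  let ι : P →ₗ[ℝ] X := (E.subtype ∘ₗ P.subtype).codRestrict X fun x ↦ x.2
  let T : E →ₗ[ℝ] X := ι ∘ₗ πP + (q.constr ℝ fun j ↦ (⟨d j, hd j⟩ : X)) ∘ₗ πQ
  have hι (x : P) : ((ι x : X) : Y) = ((x : E) : Y) := rfl
  refine ⟨T, fun e he ↦ ?_, fun e ↦ ?_⟩
  · have h1 : πP e = ⟨e, he⟩ := P.projectionOnto_apply_left hPQ ⟨e, he⟩
    have h2 : πQ e = 0 := Q.projectionOnto_apply_right hPQ.symm ⟨e, he⟩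
    simp [T, h1, h2, hι]
  · have hsumP : ∑ i, p.equivFun (πP e) i • ((p i : E) : Y) = ((πP e : E) : Y) := by
      have := congrArg (E.subtype ∘ₗ P.subtype) (p.sum_equivFun (πP e))
      simp only [map_sum, map_smul] at this
      exact this
    have hsumQ : ∑ j, q.equivFun (πQ e) j • ((q j : E) : Y) = ((πQ e : E) : Y) := by
      have := congrArg (E.subtype ∘ₗ Q.subtype) (q.sum_equivFun (πQ e))
      simp only [map_sum, map_smul] at this
      exact this
    have he : ((πP e : E) : Y) + ((πQ e : E) : Y) = e := by
      have := Submodule.projection_add_projection_eq_self hPQ e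
      exact congrArg Subtype.val this
    have hTe : ((T e : X) : Y) =
        ((πP e : E) : Y) + ∑ j, q.equivFun (πQ e) j • d j := by
      simp [T, hι, Module.Basis.constr_apply_fintype]
    have h1 := hd' (p.equivFun (πP e)) (q.equivFun (πQ e))
    rw [hsumP, hsumQ, he, ← hTe] at h1
    have h2 : ε / (C + 1) * (∑ i, |p.equivFun (πP e) i| + ∑ j, |q.equivFun (πQ e) j|) ≤
        ε * ‖e‖ := by
      calc _ ≤ ε / (C + 1) * (C * ‖e‖) := by gcongr; exact hL e
        _ = ε * ‖e‖ * (C / (C + 1)) := by ring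
        _ ≤ ε * ‖e‖ * 1 := by
            gcongr
            rw [div_le_one (by positivity)]
            linarith
        _ = ε * ‖e‖ := mul_one _
    have h3 := abs_le.1 (h1.trans h2)
    simp only [Submodule.coe_norm] at h3 ⊢
    constructor <;> linarith [h3.1, h3.2]

/-- Over a fixed tuple, all tuples of `Y` are approximated by a sequence of tuples. -/
theorem exists_seq_reflecting {m : ℕ} (k : ℕ) (f : Fin m → Y) :
    ∃ D : ℕ → Fin k → Y, ∀ (g : Fin k → Y) (δ : ℝ), 0 < δ → ∃ n,
      ∀ (b : Fin m → ℝ) (c : Fin k → ℝ),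
        |‖∑ i, b i • f i + ∑ j, c j • g j‖ - ‖∑ i, b i • f i + ∑ j, c j • D n j‖|
          ≤ δ * (∑ i, |b i| + ∑ j, |c j|) := by
  -- A tuple `g` matters only through the norm function it induces on coefficients in the compact
  -- ball `K`. Since `C(K, ℝ)` is separable, countably many tuples suffice; homogeneity removes the
  -- restriction to `K`.
  let K := Metric.closedBall (0 : (Fin m → ℝ) × (Fin k → ℝ)) 1
  let Φ (g : Fin k → Y) : C(K, ℝ) :=
    ⟨fun x ↦ ‖∑ i, x.1.1 i • f i + ∑ j, x.1.2 j • g j‖, by fun_prop⟩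
  have : CompactSpace K := isCompact_iff_compactSpace.1 (isCompact_closedBall _ _)
  have : Nonempty (Set.range Φ) := ⟨⟨Φ 0, 0, rfl⟩⟩
  let u := TopologicalSpace.denseSeq (Set.range Φ)
  choose D hD using fun n ↦ (u n).2
  refine ⟨D, fun g δ hδ ↦ ?_⟩
  obtain ⟨n, hn⟩ := (TopologicalSpace.denseRange_denseSeq (Set.range Φ)).exists_dist_lt
    ⟨Φ g, g, rfl⟩ hδ
  refine ⟨n, fun b c ↦ ?_⟩
  have hball (x : K) : |Φ g x - Φ (D n) x| ≤ δ := by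
    rw [hD n, ← Real.dist_eq]
    exact (ContinuousMap.dist_apply_le_dist x).trans hn.le
  set r := ∑ i, |b i| + ∑ j, |c j| with hr
  have hb0 : 0 ≤ ∑ i, |b i| := Finset.sum_nonneg fun _ _ ↦ abs_nonneg _
  have hc0 : 0 ≤ ∑ j, |c j| := Finset.sum_nonneg fun _ _ ↦ abs_nonneg _
  have hbr (i) : |b i| ≤ r :=
    (Finset.single_le_sum (fun i _ ↦ abs_nonneg (b i)) (Finset.mem_univ i)).trans (by linarith)
  have hcr (j) : |c j| ≤ r :=
    (Finset.single_le_sum (fun j _ ↦ abs_nonneg (c j)) (Finset.mem_univ j)).trans (by linarith)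
  rcases (show 0 ≤ r by positivity).eq_or_lt with h0 | h0
  · have hb : b = 0 := funext fun i ↦ abs_nonpos_iff.1 (h0 ▸ hbr i)
    have hc : c = 0 := funext fun j ↦ abs_nonpos_iff.1 (h0 ▸ hcr j)
    simp [hb, hc, ← h0]
  · have hmem : (r⁻¹ • b, r⁻¹ • c) ∈ K := by
      rw [mem_closedBall_zero_iff, Prod.norm_def, max_le_iff]
      constructor <;> refine (pi_norm_le_iff_of_nonneg zero_le_one).2 fun i ↦ ?_
      all_goals
        simp only [Pi.smul_apply, smul_eq_mul, norm_mul, norm_inv, Real.norm_eq_abs,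
          abs_of_pos h0]
        rw [inv_mul_le_iff₀ h0, mul_one]
      exacts [hbr i, hcr i]
    have hΦ (g' : Fin k → Y) : Φ g' ⟨_, hmem⟩ = r⁻¹ * ‖∑ i, b i • f i + ∑ j, c j • g' j‖ := by
      simp only [Φ, ContinuousMap.coe_mk, Pi.smul_apply, smul_assoc, ← Finset.smul_sum,
        ← smul_add, norm_smul, norm_inv, Real.norm_eq_abs, abs_of_pos h0]
    have := hball ⟨_, hmem⟩
    rwa [hΦ, hΦ, ← mul_sub, abs_mul, abs_inv, abs_of_pos h0, inv_mul_le_iff₀ h0, mul_comm r]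
      at this

-- There are countably many finite tuples from a dense sequence of `S`, and each needs only
-- countably many reflecting tuples. Adjoining these keeps separability; `Reflects.closure` then
-- passes to all of `S`.
open TopologicalSpace in
theorem exists_separable_reflecting (S : Submodule ℝ Y) (hS : IsSeparable (S : Set Y)) :
    ∃ X : Submodule ℝ Y, S ≤ X ∧ IsSeparable (X : Set Y) ∧ Reflects (S : Set Y) X := by
  have := hS.separableSpace
  let u (n : ℕ) : Y := denseSeq S n
  choose D hD using fun (m k : ℕ) (a : Fin m → ℕ) ↦ exists_seq_reflecting k (u ∘ a)
  let R : Set Y := ⋃ m, ⋃ k, ⋃ a, ⋃ n, ⋃ j, {D m k a n j}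
  have hR : R.Countable := by
    refine Set.countable_iUnion fun m ↦ Set.countable_iUnion fun k ↦ Set.countable_iUnion fun a ↦
      Set.countable_iUnion fun n ↦ Set.countable_iUnion fun j ↦ Set.countable_singleton _
  let X := Submodule.span ℝ (S ∪ R)
  refine ⟨X, fun x hx ↦ Submodule.subset_span (.inl hx), (hS.union hR.isSeparable).span, ?_⟩
  have hu : Reflects (Set.range u) X := by
    intro m k f hf g δ hδ
    choose a ha using hf
    obtain rfl : u ∘ a = f := funext ha
    obtain ⟨n, hn⟩ := hD m k a g δ hδ
    refine ⟨D m k a n, fun j ↦ Submodule.subset_span (.inr ?_), hn⟩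
    simp only [R, Set.mem_iUnion]
    exact ⟨m, k, a, n, j, rfl⟩
  refine hu.closure.mono (fun x hx ↦ ?_) le_rfl
  have := (denseRange_denseSeq S) ⟨x, hx⟩
  have h2 := image_closure_subset_closure_image continuous_subtype_val
    (Set.mem_image_of_mem Subtype.val this)
  rwa [← Set.range_comp] at h2

open TopologicalSpace in
/-- Every separable subspace is contained in a separable closed almost isometric ideal. -/
theorem exists_separable_isAIIdeal (S : Submodule ℝ Y) (hS : IsSeparable (S : Set Y)) :
    ∃ X : Submodule ℝ Y, S ≤ X ∧ IsClosed (X : Set Y) ∧ IsSeparable (X : Set Y) ∧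
      IsAIIdeal X := by
  let A := {S : Submodule ℝ Y // IsSeparable (S : Set Y)}
  choose F hle hsep hF using fun S : A ↦ exists_separable_reflecting S.1 S.2
  -- Any finite tuple of the union lies in a single stage `V N`, and is reflected in `V (N + 1)`.
  let V : ℕ → A := fun n ↦ Nat.rec ⟨S, hS⟩ (fun _ W ↦ ⟨F W, hsep W⟩) n
  have hmono : Monotone fun n ↦ (V n).1 := monotone_nat_of_le_succ fun n ↦ hle (V n)
  let X₀ : Submodule ℝ Y := ⨆ n, (V n).1
  have hX₀ : (X₀ : Set Y) = ⋃ n, ((V n).1 : Set Y) :=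
    Submodule.coe_iSup_of_directed _ hmono.directed_le
  have hrefl : Reflects (X₀ : Set Y) X₀ := by
    intro m k f hf g δ hδ
    rw [hX₀] at hf
    simp only [Set.mem_iUnion] at hf
    choose a ha using hf
    let N := Finset.univ.sup a
    have hN (i) : f i ∈ ((V N).1 : Set Y) := hmono (Finset.le_sup (Finset.mem_univ i)) (ha i)
    exact ((hF (V N)).mono le_rfl (le_iSup (fun n ↦ (V n).1) (N + 1))) m k f hN g δ hδ
  refine ⟨X₀.topologicalClosure, (le_iSup (fun n ↦ (V n).1) 0).trans X₀.le_topologicalClosure,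
    X₀.isClosed_topologicalClosure, ?_, ?_⟩
  · rw [Submodule.topologicalClosure_coe, hX₀]
    exact (isSeparable_iUnion.2 fun n ↦ (V n).2).closure
  · exact (hrefl.closure.mono le_rfl subset_closure).isAIIdeal

open TopologicalSpace in
theorem IsAlmostSquare.of_separable_isAIIdeal
    (h : ∀ X : Submodule ℝ Y, IsClosed (X : Set Y) → SeparableSpace X →
      IsAIIdeal X → IsAlmostSquare X) : IsAlmostSquare Y := by
  classical
  intro ε hε s hs
  obtain ⟨X, hsX, hcl, hsep, hX⟩ := exists_separable_isAIIdeal (Submodule.span ℝ (s : Set Y))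
    s.finite_toSet.isSeparable.span
  have hmem (x) (hx : x ∈ s) : x ∈ X := hsX (Submodule.subset_span hx)
  obtain ⟨y, hy, hys⟩ := h X hcl hsep.separableSpace hX ε hε
    (s.subtype (· ∈ X)) (fun x hx ↦ hs x (by simpa using hx))
  exact ⟨y, hy, fun x hx ↦ hys ⟨x, hmem x hx⟩ (by simpa using hx)⟩

end Ideals

/-! ### Weakly unconditionally Cauchy series and copies of `c₀`. -/

/-- Rosenthal's disjointification: a nonnegative matrix whose off-diagonal row sums are bounded
has an infinite principal submatrix whose off-diagonal row sums are small. -/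
theorem exists_injective_offDiag_sum_le {ε : ℝ} (hε : 0 ≤ ε) (j : ℕ) (μ : ℕ → ℕ → ℝ)
    (hμ : ∀ (n : ℕ) (F : Finset ℕ), n ∉ F → ∑ k ∈ F, μ n k ≤ j * ε) :
    ∃ m : ℕ → ℕ, m.Injective ∧
      ∀ (n : ℕ) (F : Finset ℕ), n ∉ F → ∑ k ∈ F, μ (m n) (m k) ≤ ε := by
  classical
  induction j generalizing μ with
  | zero =>
    exact ⟨id, Function.injective_id, fun n F hF ↦ (hμ n F hF).trans (by simpa using hε)⟩
  | succ j ih =>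
    -- `Nat.pair` splits ℕ into infinitely many infinite columns. If no column works, each column
    -- `p` has a row `ν p` with mass above `ε` inside that column. Among these rows, which lie in
    -- distinct columns, only `j * ε` of the bound remains.
    by_cases h : ∃ p : ℕ, ∀ (n : ℕ) (F : Finset ℕ), n ∉ F →
        ∑ k ∈ F, μ (Nat.pair p n) (Nat.pair p k) ≤ ε
    · obtain ⟨p, hp⟩ := h
      exact ⟨Nat.pair p, fun a b hab ↦ (Nat.pair_eq_pair.1 hab).2, hp⟩
    · push Not at h
      choose ν F hνF hF using h
      have hinj : Function.Injective fun p ↦ Nat.pair p (ν p) :=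
        fun a b hab ↦ (Nat.pair_eq_pair.1 hab).1
      have hbound (p : ℕ) (G : Finset ℕ) (hG : p ∉ G) :
          ∑ q ∈ G, μ (Nat.pair p (ν p)) (Nat.pair q (ν q)) ≤ j * ε := by
        have hmem : Nat.pair p (ν p) ∉
            G.image (fun q ↦ Nat.pair q (ν q)) ∪ (F p).image (Nat.pair p) := by
          simp only [Finset.mem_union, Finset.mem_image, not_or, not_exists, not_and]
          exact ⟨fun q hq hqp ↦ hG ((Nat.pair_eq_pair.1 hqp).1 ▸ hq), fun i hi hip ↦
            hνF p ((Nat.pair_eq_pair.1 hip).2 ▸ hi)⟩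
        have hdisj : Disjoint (G.image fun q ↦ Nat.pair q (ν q)) ((F p).image (Nat.pair p)) := by
          rw [Finset.disjoint_left]
          simp only [Finset.mem_image]
          rintro _ ⟨q, hq, rfl⟩ ⟨i, hi, hqi⟩
          exact hG ((Nat.pair_eq_pair.1 hqi).1 ▸ hq)
        have h1 := hμ _ _ hmem
        rw [Finset.sum_union hdisj, Finset.sum_image hinj.injOn,
          Finset.sum_image fun a _ b _ hab ↦ (Nat.pair_eq_pair.1 hab).2] at h1
        have h2 := hF p
        push_cast at h1
        linarith
      obtain ⟨m, hm, hm'⟩ := ih _ hbound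
      exact ⟨fun n ↦ Nat.pair (m n) (ν (m n)), hinj.comp hm, hm'⟩

/-- If the sums of moduli of the values of functionals in the dual ball on the terms of a sequence
are bounded, then so are its linear combinations with bounded coefficients. -/
theorem norm_sum_smul_le_of_dual {Z : Type*} [SeminormedAddCommGroup Z] [NormedSpace ℝ Z]
    {z : ℕ → Z} {C : ℝ}
    (hC : ∀ φ : StrongDual ℝ Z, ‖φ‖ ≤ 1 → ∀ F : Finset ℕ, ∑ k ∈ F, |φ (z k)| ≤ C)
    (a : ℕ → ℝ) (F : Finset ℕ) {M : ℝ} (hM : 0 ≤ M) (ha : ∀ k ∈ F, |a k| ≤ M) :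
    ‖∑ k ∈ F, a k • z k‖ ≤ C * M := by
  obtain ⟨φ, hφ, hφz⟩ := exists_dual_vector'' ℝ (∑ k ∈ F, a k • z k)
  calc ‖∑ k ∈ F, a k • z k‖ = ∑ k ∈ F, a k * φ (z k) := by
        have : φ (∑ k ∈ F, a k • z k) = ‖∑ k ∈ F, a k • z k‖ := hφz
        rw [← this]
        simp
    _ ≤ ∑ k ∈ F, M * |φ (z k)| := by
        refine Finset.sum_le_sum fun k hk ↦ (le_abs_self _).trans ?_
        rw [abs_mul]
        gcongr
        exact ha k hk
    _ = M * ∑ k ∈ F, |φ (z k)| := by rw [Finset.mul_sum]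
    _ ≤ M * C := by gcongr; exact hC φ hφ F
    _ = C * M := mul_comm _ _

theorem ZeroAtInftyContinuousMap.abs_apply_le_norm (a : C₀(ℕ, ℝ)) (k : ℕ) : |a k| ≤ ‖a‖ := by
  rw [← ZeroAtInftyContinuousMap.norm_toBCF_eq_norm]
  exact a.toBCF.norm_coe_le_norm k

theorem ZeroAtInftyContinuousMap.norm_le_of_abs_apply_le {a : C₀(ℕ, ℝ)} {M : ℝ} (hM : 0 ≤ M)
    (h : ∀ k, |a k| ≤ M) : ‖a‖ ≤ M := by
  rw [← ZeroAtInftyContinuousMap.norm_toBCF_eq_norm]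
  exact (BoundedContinuousFunction.norm_le hM).2 h

theorem summable_zeroAtInfty_smul {Z : Type*} [NormedAddCommGroup Z] [NormedSpace ℝ Z]
    [CompleteSpace Z] {z : ℕ → Z} {C : ℝ}
    (hC : ∀ φ : StrongDual ℝ Z, ‖φ‖ ≤ 1 → ∀ F : Finset ℕ, ∑ k ∈ F, |φ (z k)| ≤ C)
    (a : C₀(ℕ, ℝ)) : Summable fun k ↦ a k • z k := by
  have hC0 : 0 ≤ C := by simpa using hC 0 (by simp) ∅
  rw [summable_iff_vanishing_norm]
  intro ε hε
  have hη : 0 < ε / (C + 1) := by positivity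
  have ha : Filter.Tendsto (a : ℕ → ℝ) Filter.cofinite (nhds 0) := by
    rw [← Filter.cocompact_eq_cofinite]
    exact a.zero_at_infty'
  have hfin := (Metric.tendsto_nhds.1 ha) _ hη
  rw [Filter.eventually_cofinite] at hfin
  refine ⟨hfin.toFinset, fun t ht ↦ ?_⟩
  have : ‖∑ k ∈ t, a k • z k‖ ≤ C * (ε / (C + 1)) := by
    refine norm_sum_smul_le_of_dual hC a t hη.le fun k hk ↦ ?_
    have := Finset.disjoint_left.1 ht hk
    simp only [Set.Finite.mem_toFinset, Set.mem_ofPred_eq, not_not, dist_zero_right,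
      Real.norm_eq_abs] at this
    exact this.le
  refine this.trans_lt ?_
  rw [mul_div_assoc', div_lt_iff₀ (by positivity)]
  linarith

/-- A weakly unconditionally Cauchy series with terms bounded away from zero yields a copy
of `c₀`. -/
theorem containsCopyOfCZero_of_dual {Z : Type*} [NormedAddCommGroup Z] [NormedSpace ℝ Z]
    [CompleteSpace Z] {z : ℕ → Z} {C δ : ℝ} (hδ : 0 < δ) (hz : ∀ n, δ ≤ ‖z n‖)
    (hC : ∀ φ : StrongDual ℝ Z, ‖φ‖ ≤ 1 → ∀ F : Finset ℕ, ∑ k ∈ F, |φ (z k)| ≤ C) :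
    ContainsCopyOfCZero Z := by
  classical
  choose φ hφ hφz using fun n ↦ exists_dual_vector'' ℝ (z n)
  obtain ⟨j, hj⟩ := exists_nat_ge (C / (δ / 2))
  rw [div_le_iff₀ (by positivity)] at hj
  obtain ⟨m, hm, hmε⟩ := exists_injective_offDiag_sum_le (half_pos hδ).le j
    (fun n k ↦ |φ n (z k)|) fun n F _ ↦ (hC (φ n) (hφ n) F).trans hj
  have hC' (ψ : StrongDual ℝ Z) (hψ : ‖ψ‖ ≤ 1) (F : Finset ℕ) :
      ∑ k ∈ F, |ψ (z (m k))| ≤ C := by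
    have := hC ψ hψ (F.image m)
    rwa [Finset.sum_image hm.injOn] at this
  have hsum (a : C₀(ℕ, ℝ)) : Summable fun k ↦ a k • z (m k) :=
    summable_zeroAtInfty_smul (z := z ∘ m) hC' a
  let S : C₀(ℕ, ℝ) →ₗ[ℝ] Z :=
    { toFun := fun a ↦ ∑' k, a k • z (m k)
      map_add' := fun a b ↦ by
        rw [← (hsum a).tsum_add (hsum b)]
        exact tsum_congr fun k ↦ add_smul _ _ _
      map_smul' := fun c a ↦ by
        rw [RingHom.id_apply, ← (hsum a).tsum_const_smul]
        exact tsum_congr fun k ↦ mul_smul c _ _ }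
  have hS (a : C₀(ℕ, ℝ)) : HasSum (fun k ↦ a k • z (m k)) (S a) := (hsum a).hasSum
  have hupper (a : C₀(ℕ, ℝ)) : ‖S a‖ ≤ C * ‖a‖ :=
    le_of_tendsto (hS a).norm (.of_forall fun F ↦
      norm_sum_smul_le_of_dual hC' a F (norm_nonneg a) fun k _ ↦ a.abs_apply_le_norm k)
  -- The functional norming `z (m n)` sees at least `|a n| * δ` from that term, and at most `δ / 2 *
  -- ‖a‖` from all others.
  have hcoord (a : C₀(ℕ, ℝ)) (n : ℕ) : |a n| * δ ≤ ‖S a‖ + δ / 2 * ‖a‖ := by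
    rw [← sub_le_iff_le_add]
    refine ge_of_tendsto (hS a).norm ?_
    filter_upwards [Filter.eventually_ge_atTop {n}] with F hF
    have hn : n ∈ F := hF (Finset.mem_singleton_self n)
    have h1 : |φ (m n) (∑ k ∈ F, a k • z (m k))| ≤ ‖∑ k ∈ F, a k • z (m k)‖ :=
      ((φ (m n)).le_opNorm _).trans (mul_le_of_le_one_left (norm_nonneg _) (hφ _))
    have h2 : φ (m n) (∑ k ∈ F, a k • z (m k)) =
        a n * ‖z (m n)‖ + ∑ k ∈ F.erase n, a k * φ (m n) (z (m k)) := by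
      rw [map_sum, ← Finset.add_sum_erase _ _ hn]
      simp [hφz]
    have h3 : |∑ k ∈ F.erase n, a k * φ (m n) (z (m k))| ≤ δ / 2 * ‖a‖ := by
      calc _ ≤ ∑ k ∈ F.erase n, |a k * φ (m n) (z (m k))| := Finset.abs_sum_le_sum_abs _ _
        _ ≤ ∑ k ∈ F.erase n, ‖a‖ * |φ (m n) (z (m k))| := by
            refine Finset.sum_le_sum fun k _ ↦ ?_
            rw [abs_mul]
            gcongr
            exact a.abs_apply_le_norm k
        _ = ‖a‖ * ∑ k ∈ F.erase n, |φ (m n) (z (m k))| := by rw [Finset.mul_sum]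
        _ ≤ ‖a‖ * (δ / 2) := by gcongr; exact hmε n _ (Finset.notMem_erase n F)
        _ = _ := mul_comm _ _
    have h4 : |a n| * δ ≤ |a n * ‖z (m n)‖| := by
      rw [abs_mul, abs_norm]
      gcongr
      exact hz _
    have h5 := abs_sub_abs_le_abs_add (a n * ‖z (m n)‖)
      (∑ k ∈ F.erase n, a k * φ (m n) (z (m k)))
    rw [← h2] at h5
    linarith
  have hlower (a : C₀(ℕ, ℝ)) : ‖a‖ ≤ 2 / δ * ‖S a‖ := by
    have h1 : ‖a‖ ≤ (‖S a‖ + δ / 2 * ‖a‖) / δ :=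
      a.norm_le_of_abs_apply_le (by positivity) fun n ↦ (le_div_iff₀ hδ).2 (hcoord a n)
    rw [le_div_iff₀ hδ] at h1
    rw [div_mul_eq_mul_div, le_div_iff₀ hδ]
    linarith
  have hinj : Function.Injective S := (injective_iff_map_eq_zero S).2 fun a ha ↦ by
    simpa [ha] using hlower a
  refine ⟨LinearMap.range S, ⟨(LinearEquiv.ofInjective S hinj).toContinuousLinearEquivOfBounds
    C (2 / δ) hupper fun w ↦ ?_⟩⟩
  obtain ⟨a, rfl⟩ := (LinearEquiv.ofInjective S hinj).surjective w
  rw [LinearEquiv.symm_apply_apply]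
  exact hlower a

/-- A finite-dimensional space does not contain a copy of `c₀`. -/
theorem not_containsCopyOfCZero_of_finiteDimensional (Z : Type*) [SeminormedAddCommGroup Z]
    [NormedSpace ℝ Z] [FiniteDimensional ℝ Z] : ¬ ContainsCopyOfCZero Z := by
  rintro ⟨W, ⟨e⟩⟩
  have : FiniteDimensional ℝ C₀(ℕ, ℝ) := e.toLinearEquiv.symm.finiteDimensional
  let u (n : ℕ) : C₀(ℕ, ℝ) :=
    ⟨⟨(Pi.single n 1 : ℕ → ℝ), continuous_of_discreteTopology⟩, by
      rw [Filter.cocompact_eq_cofinite]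
      refine tendsto_const_nhds.congr' ?_
      filter_upwards [(Set.finite_singleton n).compl_mem_cofinite] with k hk
      exact (Pi.single_eq_of_ne (M := fun _ ↦ ℝ) hk 1).symm⟩
  have hu : LinearIndependent ℝ u := by
    let coe : C₀(ℕ, ℝ) →ₗ[ℝ] ℕ → ℝ :=
      { toFun := fun a ↦ a, map_add' := fun _ _ ↦ rfl, map_smul' := fun _ _ ↦ rfl }
    refine LinearIndependent.of_comp coe ?_
    exact Pi.linearIndependent_single_one ℕ ℝ
  exact (LinearIndependent.finite hu).false

/-! ### Sequences in almost square spaces and passage to subspaces. -/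

section AlmostSquare

variable {Y : Type*} [NormedAddCommGroup Y] [NormedSpace ℝ Y]

/-- With `v` the normalised `u`, `u + y` is a convex combination of `v + y` and `y` when `‖u‖ ≤ 1`,
and is `v + y` plus `(‖u‖ - 1) • v` otherwise. -/
theorem norm_add_le_of_norm_smul_add_le {u y : Y} {η : ℝ} (hη : 0 ≤ η) (hy : ‖y‖ = 1)
    (h : ‖(‖u‖⁻¹ • u) + y‖ ≤ 1 + η) : ‖u + y‖ ≤ (1 + η) * max ‖u‖ 1 := by
  rcases eq_or_ne u 0 with rfl | hu
  · simp [hy, hη]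
  have hu0 : 0 < ‖u‖ := norm_pos_iff.2 hu
  set v := ‖u‖⁻¹ • u with hv
  have huv : u = ‖u‖ • v := by rw [hv, smul_inv_smul₀ hu0.ne']
  have hv1 : ‖v‖ = 1 := by rw [hv, norm_smul, norm_inv, norm_norm, inv_mul_cancel₀ hu0.ne']
  rcases le_total ‖u‖ 1 with h1 | h1
  · rw [max_eq_right h1]
    calc ‖u + y‖ = ‖‖u‖ • (v + y) + (1 - ‖u‖) • y‖ := by
          conv_lhs => rw [huv]
          congr 1
          module
      _ ≤ ‖u‖ * ‖v + y‖ + (1 - ‖u‖) * ‖y‖ := by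
          refine (norm_add_le _ _).trans ?_
          rw [norm_smul, norm_smul, norm_norm, Real.norm_of_nonneg (by linarith)]
      _ ≤ ‖u‖ * (1 + η) + (1 - ‖u‖) * (1 + η) := by
          rw [hy]
          gcongr
          linarith
      _ = (1 + η) * 1 := by ring
  · rw [max_eq_left h1]
    calc ‖u + y‖ = ‖(v + y) + (‖u‖ - 1) • v‖ := by
          conv_lhs => rw [huv]
          congr 1
          module
      _ ≤ ‖v + y‖ + (‖u‖ - 1) * ‖v‖ := by
          refine (norm_add_le _ _).trans ?_
          rw [norm_smul, Real.norm_of_nonneg (by linarith)]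
      _ ≤ (1 + η) + (‖u‖ - 1) * (1 + η) := by
          rw [hv1]
          gcongr
          linarith
      _ = (1 + η) * ‖u‖ := by ring

/-- In an almost square space, unit vectors almost orthogonal, in the sense of the supremum norm,
to finitely many given vectors. -/
theorem IsAlmostSquare.exists_norm_add_le (hY : IsAlmostSquare Y) {ε η : ℝ} (hε : 0 < ε)
    (hη : 0 < η) {s : Finset Y} (hs : ∀ x ∈ s, ‖x‖ = 1) (V : Finset Y) :
    ∃ y : Y, ‖y‖ = 1 ∧ (∀ x ∈ s, ‖x - y‖ ≤ 1 + ε) ∧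
      ∀ v ∈ V, ‖v + y‖ ≤ (1 + η) * max ‖v‖ 1 ∧ ‖v - y‖ ≤ (1 + η) * max ‖v‖ 1 := by
  classical
  -- Negatives are included because almost squareness controls only `x - y`, not `x + y`.
  let U : Finset Y := ((V ∪ V.image (- ·)).filter (· ≠ 0)).image fun v ↦ ‖v‖⁻¹ • v
  have hU (x) (hx : x ∈ U) : ‖x‖ = 1 := by
    obtain ⟨v, hv, rfl⟩ := Finset.mem_image.1 hx
    have hv0 : ‖v‖ ≠ 0 := norm_ne_zero_iff.2 (Finset.mem_filter.1 hv).2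
    rw [norm_smul, norm_inv, norm_norm, inv_mul_cancel₀ hv0]
  obtain ⟨y, hy, hys⟩ := hY (min ε η) (lt_min hε hη) (s ∪ U) fun x hx ↦
    (Finset.mem_union.1 hx).elim (hs x) (hU x)
  have key (v : Y) (hv : v ∈ V ∪ V.image (- ·)) : ‖v - y‖ ≤ (1 + η) * max ‖v‖ 1 := by
    rw [sub_eq_add_neg]
    refine norm_add_le_of_norm_smul_add_le hη.le (by rwa [norm_neg]) ?_
    rcases eq_or_ne v 0 with rfl | hv0
    · simp [hy, hη.le]
    rw [← sub_eq_add_neg]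
    refine (hys _ (Finset.mem_union_right _ (Finset.mem_image_of_mem _
      (Finset.mem_filter.2 ⟨hv, hv0⟩)))).trans ?_
    gcongr
    exact min_le_right _ _
  refine ⟨y, hy, fun x hx ↦ (hys x (Finset.mem_union_left _ hx)).trans ?_, fun v hv ↦ ⟨?_, ?_⟩⟩
  · gcongr
    exact min_le_left _ _
  · have := key (-v) (Finset.mem_union_right _ (Finset.mem_image_of_mem _ hv))
    rwa [norm_neg, ← norm_neg, neg_sub, sub_neg_eq_add, add_comm] at this
  · exact key v (Finset.mem_union_left _ hv)

/-- An almost square space contains, near any finite set of unit vectors in the sense of the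
definition, normalised sequences generating weakly unconditionally Cauchy series. -/
theorem IsAlmostSquare.exists_seq (hY : IsAlmostSquare Y) {ε : ℝ} (hε : 0 < ε)
    {s : Finset Y} (hs : ∀ x ∈ s, ‖x‖ = 1) :
    ∃ y : ℕ → Y, (∀ n, ‖y n‖ = 1) ∧ (∀ n, ∀ x ∈ s, ‖x - y n‖ ≤ 1 + ε) ∧
      ∀ φ : StrongDual ℝ Y, ‖φ‖ ≤ 1 → ∀ F : Finset ℕ, ∑ k ∈ F, |φ (y k)| ≤ 2 := by
  classical
  have hη (n : ℕ) : (0 : ℝ) < (1 / 2) ^ (n + 2) := by positivity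
  choose g hg hgs hgV using fun (V : Finset Y) (n : ℕ) ↦ hY.exists_norm_add_le hε (hη n) hs V
  -- `V n` consists of all signed sums of the first `n` terms, each new term being chosen against
  -- all of them.
  let V : ℕ → Finset Y := fun n ↦ Nat.rec {0}
    (fun n W ↦ W.image (· + g W n) ∪ W.image (· - g W n)) n
  have hV (n : ℕ) : V (n + 1) = (V n).image (· + g (V n) n) ∪ (V n).image (· - g (V n) n) := rfl
  -- With `p = (1 / 2) ^ n`, the induction is `(1 + p / 4) * (2 - p) ≤ 2 - p / 2`.
  have hbound (n : ℕ) : ∀ v ∈ V n, ‖v‖ ≤ 2 - (1 / 2) ^ n := by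
    induction n with
    | zero => simp [V]
    | succ n ih =>
      have hpow : (1 / 2 : ℝ) ^ n ≤ 1 := pow_le_one₀ (by norm_num) (by norm_num)
      have hpow0 : (0 : ℝ) < (1 / 2) ^ n := by positivity
      have key (v : Y) (hv : v ∈ V n) :
          (1 + (1 / 2 : ℝ) ^ (n + 2)) * max ‖v‖ 1 ≤ 2 - (1 / 2) ^ (n + 1) := by
        have : max ‖v‖ 1 ≤ 2 - (1 / 2 : ℝ) ^ n := max_le (ih v hv) (by linarith)
        refine (mul_le_mul_of_nonneg_left this (by positivity)).trans ?_
        have h1 : (1 / 2 : ℝ) ^ (n + 1) = (1 / 2) ^ n / 2 := by ring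
        have h2 : (1 / 2 : ℝ) ^ (n + 2) = (1 / 2) ^ n / 4 := by ring
        rw [h1, h2]
        nlinarith
      intro v hv
      rw [hV, Finset.mem_union, Finset.mem_image, Finset.mem_image] at hv
      rcases hv with ⟨w, hw, rfl⟩ | ⟨w, hw, rfl⟩
      · exact (hgV _ _ w hw).1.trans (key w hw)
      · exact (hgV _ _ w hw).2.trans (key w hw)
  refine ⟨fun n ↦ g (V n) n, fun n ↦ hg _ _, fun n ↦ hgs _ _, fun φ hφ F ↦ ?_⟩
  have hsign (N : ℕ) : ∃ v ∈ V N, φ v = ∑ k ∈ Finset.range N, |φ (g (V k) k)| := by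
    induction N with
    | zero => exact ⟨0, by simp [V], by simp⟩
    | succ N ih =>
      obtain ⟨v, hv, hφv⟩ := ih
      rw [Finset.sum_range_succ, ← hφv, hV]
      rcases abs_cases (φ (g (V N) N)) with h | h
      · exact ⟨v + g (V N) N,
          Finset.mem_union_left _ (Finset.mem_image_of_mem _ hv), by rw [map_add, h.1]⟩
      · exact ⟨v - g (V N) N,
          Finset.mem_union_right _ (Finset.mem_image_of_mem _ hv), by
            rw [map_sub, h.1, sub_eq_add_neg]⟩
  obtain ⟨N, hN⟩ := F.exists_nat_subset_range
  obtain ⟨v, hv, hφv⟩ := hsign N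
  calc ∑ k ∈ F, |φ (g (V k) k)| ≤ ∑ k ∈ Finset.range N, |φ (g (V k) k)| :=
        Finset.sum_le_sum_of_subset_of_nonneg hN fun _ _ _ ↦ abs_nonneg _
    _ = φ v := hφv.symm
    _ ≤ ‖φ v‖ := le_abs_self _
    _ ≤ ‖φ‖ * ‖v‖ := φ.le_opNorm v
    _ ≤ 1 * 2 := by
        gcongr
        exact (hbound N v hv).trans (by simp)
    _ = 2 := one_mul 2

/-- Almost squareness passes to closed subspaces whose quotient contains no copy of `c₀`. -/
theorem IsAlmostSquare.of_not_containsCopyOfCZero_quotient [CompleteSpace Y]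
    (hY : IsAlmostSquare Y) {X : Submodule ℝ Y} (hX : IsClosed (X : Set Y))
    (hc : ¬ ContainsCopyOfCZero (Y ⧸ X)) : IsAlmostSquare X := by
  classical
  refine .of_approx fun ε hε s hs ↦ ?_
  obtain ⟨y, hy, hys, hφ⟩ := hY.exists_seq (half_pos hε) (s := s.image X.subtype)
    (by simpa using hs)
  obtain ⟨n, hn⟩ : ∃ n, ‖X.mkQ (y n)‖ < ε / 2 := by
    by_contra! h
    refine hc (containsCopyOfCZero_of_dual (C := 2) (half_pos hε) h fun ψ hψ F ↦ ?_)
    let π : Y →L[ℝ] Y ⧸ X := X.mkQ.mkContinuous 1 fun x ↦ by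
      simpa using Submodule.Quotient.norm_mk_le X x
    have hπ : ‖π‖ ≤ 1 := LinearMap.mkContinuous_norm_le _ zero_le_one _
    exact hφ (ψ ∘L π) ((ψ.opNorm_comp_le π).trans (mul_le_one₀ hψ (norm_nonneg _) hπ)) F
  -- Lift the small class of `y n` to a small `w`; then `y n - w` is the approximate witness in `X`.
  obtain ⟨w, hw, hwn⟩ := Submodule.Quotient.norm_mk_lt (X.mkQ (y n)) (sub_pos.2 hn)
  rw [add_sub_cancel] at hwn
  have hmem : y n - w ∈ X := by
    rw [← Submodule.Quotient.mk_eq_zero, Submodule.Quotient.mk_sub, hw]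
    exact sub_self _
  refine ⟨⟨y n - w, hmem⟩, ?_, fun x hx ↦ ?_⟩
  · have := abs_norm_sub_norm_le (y n - w) (y n)
    rw [hy, sub_sub_cancel_left, norm_neg] at this
    exact this.trans (by linarith)
  · have h1 := hys n x (Finset.mem_image_of_mem _ hx)
    calc ‖(x : Y) - (y n - w)‖ = ‖(x - y n) + w‖ := by congr 1; abel
      _ ≤ ‖(x : Y) - y n‖ + ‖w‖ := norm_add_le _ _
      _ ≤ (1 + ε / 2) + ε / 2 := add_le_add h1 hwn.le
      _ = 1 + ε := by ring

theorem IsAlmostSquare.of_top (h : IsAlmostSquare (⊤ : Submodule ℝ Y)) : IsAlmostSquare Y := by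
  classical
  intro ε hε s hs
  obtain ⟨y, hy, hys⟩ := h ε hε (s.subtype (· ∈ (⊤ : Submodule ℝ Y)))
    (fun x hx ↦ hs x (by simpa using hx))
  exact ⟨y, hy, fun x hx ↦ hys ⟨x, trivial⟩ (by simpa using hx)⟩

end AlmostSquare

theorem mainTheorem4 (Y : Type*) [NormedAddCommGroup Y] [NormedSpace ℝ Y] [CompleteSpace Y] :
    List.TFAE [
      IsAlmostSquare Y,
      ∀ X : Submodule ℝ Y, IsClosed (X : Set Y) → TopologicalSpace.SeparableSpace X →
        IsAIIdeal X → IsAlmostSquare X,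
      ∀ X : Submodule ℝ Y, IsClosed (X : Set Y) → ¬ ContainsCopyOfCZero (Y ⧸ X) →
        IsAlmostSquare X,
      ∀ X : Submodule ℝ Y, IsClosed (X : Set Y) → FiniteDimensional ℝ (Y ⧸ X) →
        IsAlmostSquare X] := by
  tfae_have 1 → 2 := fun h X _ _ hX ↦ h.of_isAIIdeal hX
  tfae_have 2 → 1 := IsAlmostSquare.of_separable_isAIIdeal
  tfae_have 1 → 3 := fun h X hX hc ↦ h.of_not_containsCopyOfCZero_quotient hX hc
  tfae_have 3 → 4 := fun h X hX _ ↦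
    h X hX (not_containsCopyOfCZero_of_finiteDimensional (Y ⧸ X))
  tfae_have 4 → 1 := fun h ↦ .of_top (h ⊤ isClosed_univ inferInstance)
  tfae_finish
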